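/- Let $\Gamma$ be a simple graph (finite or infinite) with vertex set $V$, and let $(G_v)_{v\in V}$ be a family of groups. The graph product $\Gamma\mathcal{G}$ is the quotient of the free product $\ast_{v\in V}G_v$ by the normal closure of all commutators $[a,b]$ with $a\in G_u$, $b\in G_v$ and $\{u,v\}$ an edge of $\Gamma$. A group is called cyclic subgroup separable (CSS) if each of its cyclic subgroups is closed in the profinite topology, that is, the topology with basis the cosets $gN$ of normal subgroups $N$ of finite index. If every vertex group $G_v$ is CSS, then the graph product $\Gamma\mathcal{G}$ is CSS. -/

import Mathlib

/-- The profinite topology on a group `G`: the topology with basis the cosets `x N`, where `N` runs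
through the normal subgroups of finite index of `G`. A set is open iff with each of its points `x`
it contains a coset `x N` of such a subgroup. -/
abbrev profiniteTopology (G : Type*) [Group G] : TopologicalSpace G where
  IsOpen U := ∀ x ∈ U, ∃ N : Subgroup G, N.Normal ∧ N.FiniteIndex ∧ ∀ n ∈ N, x * n ∈ U
  isOpen_univ := fun _ _ => ⟨⊤, inferInstance, inferInstance, fun _ _ => trivial⟩
  isOpen_inter := by
    rintro U V hU hV x ⟨hxU, hxV⟩
    obtain ⟨N, hN, hNf, hNU⟩ := hU x hxU
    obtain ⟨M, hM, hMf, hMV⟩ := hV x hxV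
    exact ⟨N ⊓ M, inferInstance, inferInstance, fun n hn => ⟨hNU n hn.1, hMV n hn.2⟩⟩
  isOpen_sUnion := by
    rintro S hS x ⟨U, hU, hxU⟩
    obtain ⟨N, hN, hNf, hNU⟩ := hS U hU x hxU
    exact ⟨N, hN, hNf, fun n hn => ⟨U, hU, hNU n hn⟩⟩

/-- A group is cyclic subgroup separable (CSS) if each of its cyclic subgroups is closed in the
profinite topology. -/
def IsCyclicSubgroupSeparable (G : Type*) [Group G] : Prop :=
  ∀ H : Subgroup G, IsCyclic H → @IsClosed G (profiniteTopology G) (H : Set G)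

/-- The commutators of elements of vertex groups at adjacent vertices, in the free product of all
vertex groups. -/
def graphProductRel {V : Type*} (Γ : SimpleGraph V) (G : V → Type*) [∀ v, Group (G v)] :
    Set (Monoid.CoprodI G) :=
  {r | ∃ u v : V, Γ.Adj u v ∧ ∃ (a : G u) (b : G v),
    r = Monoid.CoprodI.of a * Monoid.CoprodI.of b *
      (Monoid.CoprodI.of a)⁻¹ * (Monoid.CoprodI.of b)⁻¹}

/-- The graph product of the vertex groups `G v` along the simple graph `Γ`: the free product of the
vertex groups modulo the relations `a b = b a` for `a ∈ G u`, `b ∈ G v` with `u`, `v` adjacent. -/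
abbrev GraphProduct {V : Type*} (Γ : SimpleGraph V) (G : V → Type*) [∀ v, Group (G v)] : Type _ :=
  Monoid.CoprodI G ⧸ Subgroup.normalClosure (graphProductRel Γ G)

/-! Map the graph product to the direct product of the vertex groups by `toPi`. If some coordinate
of `g` has infinite order, cyclic separability of that vertex group controls exponents modulo every
`M`, and residual finiteness of the graph product does the rest
(`IsResiduallyFinite.isClosed_zpowers_of_map`). Otherwise a positive power of `g` lies in the kernel
of `toPi`, and it suffices to treat that power (`isClosed_zpowers_of_pow`).

For a nontrivial element written as a reduced word, finite quotients of the vertex groups yield an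
integral representation of finite rank in which the element acts nontrivially and the whole kernel
of `toPi` acts unipotently (`exists_rep`). Reduction modulo 2 proves residual finiteness. For a
kernel element, the powers act on a suitable vector by `f + j • w`, so congruence quotients detect
the exponent `j` (`IsResiduallyFinite.isClosed_zpowers_of_unipotent`). -/

section Separability

/-! ### Closed cyclic subgroups and residual finiteness. -/

variable {G : Type*} [Group G]

/-- A group is residually finite if its normal subgroups of finite index intersect trivially. -/
def IsResiduallyFinite (G : Type*) [Group G] : Prop :=
  ∀ x : G, x ≠ 1 → ∃ N : Subgroup G, N.Normal ∧ N.FiniteIndex ∧ x ∉ N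

theorem isClosed_profiniteTopology_zpowers_iff {g : G} :
    @IsClosed G (profiniteTopology G) (Subgroup.zpowers g : Set G) ↔
      ∀ x ∉ Subgroup.zpowers g, ∃ N : Subgroup G, N.Normal ∧ N.FiniteIndex ∧
        ∀ j : ℤ, x⁻¹ * g ^ j ∉ N := by
  rw [← @isOpen_compl_iff G _ (profiniteTopology G)]
  change (∀ x ∈ ((Subgroup.zpowers g : Set G))ᶜ, ∃ N : Subgroup G, N.Normal ∧ N.FiniteIndex ∧
    ∀ n ∈ N, x * n ∈ ((Subgroup.zpowers g : Set G))ᶜ) ↔ _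
  refine forall₂_congr fun x _ => exists_congr fun N => and_congr_right fun _ =>
    and_congr_right fun _ => ⟨fun h j hj => ?_, fun h n hn hx => ?_⟩
  · exact h _ hj ⟨j, by simp⟩
  · obtain ⟨j, hj⟩ := hx
    refine h j ?_
    simp only at hj
    rw [hj]
    simpa using hn

theorem isResiduallyFinite_iff_isClosed_zpowers_one :
    IsResiduallyFinite G ↔
      @IsClosed G (profiniteTopology G) (Subgroup.zpowers (1 : G) : Set G) := by
  rw [isClosed_profiniteTopology_zpowers_iff]
  simp [IsResiduallyFinite]

theorem IsCyclicSubgroupSeparable.isClosed_zpowers (hG : IsCyclicSubgroupSeparable G) (g : G) :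
    @IsClosed G (profiniteTopology G) (Subgroup.zpowers g : Set G) :=
  hG _ inferInstance

theorem isCyclicSubgroupSeparable_of_isClosed_zpowers
    (h : ∀ g : G, @IsClosed G (profiniteTopology G) (Subgroup.zpowers g : Set G)) :
    IsCyclicSubgroupSeparable G := by
  intro H hH
  obtain ⟨g, rfl⟩ := (Subgroup.isCyclic_iff_exists_zpowers_eq_top H).1 hH
  exact h g

theorem IsCyclicSubgroupSeparable.isResiduallyFinite (hG : IsCyclicSubgroupSeparable G) :
    IsResiduallyFinite G :=
  isResiduallyFinite_iff_isClosed_zpowers_one.2 (hG.isClosed_zpowers 1)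

/-- If a positive power of `g` generates a closed subgroup, then so does `g`. -/
theorem isClosed_zpowers_of_pow {g : G} {m : ℕ} (hm : 0 < m)
    (h : @IsClosed G (profiniteTopology G) (Subgroup.zpowers (g ^ m) : Set G)) :
    @IsClosed G (profiniteTopology G) (Subgroup.zpowers g : Set G) := by
  rw [isClosed_profiniteTopology_zpowers_iff] at h ⊢
  intro x hx
  -- The subgroup generated by `g` is a union of `m` cosets of the one generated by `g ^ m`; each is
  -- separated from `x` on its own.
  have key : ∀ r : Fin m, ∃ N : Subgroup G, N.Normal ∧ N.FiniteIndex ∧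
      ∀ j : ℤ, (x * g ^ (-(r : ℤ)))⁻¹ * (g ^ m) ^ j ∉ N := by
    refine fun r => h _ fun ⟨j, hj⟩ => hx ⟨m * j + r, ?_⟩
    simp only at hj ⊢
    rw [zpow_add, zpow_mul, zpow_natCast, hj]
    group
  choose N hN hNf hNx using key
  refine ⟨⨅ r, N r, Subgroup.normal_iInf_normal hN, Subgroup.finiteIndex_iInf hNf,
    fun j hj => ?_⟩
  have hm' : (m : ℤ) ≠ 0 := by omega
  have h0 := Int.emod_nonneg j hm'
  have h1 := Int.emod_lt_of_pos j (by omega : (0 : ℤ) < m)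
  obtain ⟨r, hr⟩ := Int.eq_ofNat_of_zero_le h0
  have hrm : r < m := by omega
  refine hNx ⟨r, hrm⟩ (j / m) ?_
  have := (hN ⟨r, hrm⟩).conj_mem _ (Subgroup.mem_iInf.1 hj ⟨r, hrm⟩) (g ^ (r : ℤ))
  have e : (x * g ^ (-(r : ℤ)))⁻¹ * (g ^ m) ^ (j / m) =
      g ^ (r : ℤ) * (x⁻¹ * g ^ j) * (g ^ (r : ℤ))⁻¹ := by
    have : (g ^ m) ^ (j / (m : ℤ)) = g ^ (j - r) := by
      rw [← zpow_natCast, ← zpow_mul]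
      congr 1
      have := Int.mul_ediv_add_emod j m
      omega
    rw [this]
    group
  simpa only [e] using this

/-- In a cyclic subgroup separable group, the finite quotients induce the full profinite topology
on each infinite cyclic subgroup. -/
theorem IsCyclicSubgroupSeparable.exists_dvd_of_zpow_mem (hG : IsCyclicSubgroupSeparable G)
    {g : G} (hg : ¬ IsOfFinOrder g) {M : ℕ} (hM : 0 < M) :
    ∃ N : Subgroup G, N.Normal ∧ N.FiniteIndex ∧ ∀ j : ℤ, g ^ j ∈ N → (M : ℤ) ∣ j := by
  have hinj := injective_zpow_iff_not_isOfFinOrder.2 hg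
  have h := isClosed_profiniteTopology_zpowers_iff.1 (hG.isClosed_zpowers (g ^ M))
  -- As `g` has infinite order, `g ^ i` with `0 < i < M` is not a power of `g ^ M`, hence can be
  -- separated from all of them.
  have key : ∀ i : Fin M, ∃ N : Subgroup G, N.Normal ∧ N.FiniteIndex ∧
      ((i : ℕ) ≠ 0 → ∀ j : ℤ, (g ^ (i : ℤ))⁻¹ * (g ^ M) ^ j ∉ N) := by
    intro i
    by_cases hi : (i : ℕ) = 0
    · exact ⟨⊤, inferInstance, inferInstance, fun h => (h hi).elim⟩
    obtain ⟨N, h1, h2, h3⟩ := h (g ^ (i : ℤ)) (by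
      rintro ⟨j, hj⟩
      simp only at hj
      rw [← zpow_natCast, ← zpow_mul] at hj
      have hd : (M : ℤ) ∣ i := ⟨j, (hinj hj).symm⟩
      exact hi (Nat.eq_zero_of_dvd_of_lt (Int.natCast_dvd_natCast.1 hd) i.2))
    exact ⟨N, h1, h2, fun _ => h3⟩
  choose N hN hNf hNx using key
  refine ⟨⨅ r, N r, Subgroup.normal_iInf_normal hN, Subgroup.finiteIndex_iInf hNf,
    fun j hj => ?_⟩
  have hm' : (M : ℤ) ≠ 0 := by omega
  have h0 := Int.emod_nonneg j hm'
  have h1 := Int.emod_lt_of_pos j (by omega : (0 : ℤ) < M)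
  obtain ⟨r, hr⟩ := Int.eq_ofNat_of_zero_le h0
  have hrm : r < M := by omega
  rcases Nat.eq_zero_or_pos r with rfl | hr0
  · exact Int.dvd_of_emod_eq_zero (by simpa using hr)
  refine (hNx ⟨r, hrm⟩ hr0.ne' (-(j / M)) ?_).elim
  have e : (g ^ (r : ℤ))⁻¹ * (g ^ M) ^ (-(j / (M : ℤ))) = (g ^ j)⁻¹ := by
    rw [← zpow_natCast g M, ← zpow_mul, ← zpow_neg, ← zpow_neg, ← zpow_add]
    congr 1
    have := Int.mul_ediv_add_emod j M
    rw [mul_neg]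
    omega
  simpa only [e] using (N ⟨r, hrm⟩).inv_mem (Subgroup.mem_iInf.1 hj ⟨r, hrm⟩)

/-- A criterion for a cyclic subgroup of a residually finite group to be closed. -/
theorem IsResiduallyFinite.isClosed_zpowers (hG : IsResiduallyFinite G) {g : G}
    (h : ∀ x ∉ Subgroup.zpowers g,
      (∃ N : Subgroup G, N.Normal ∧ N.FiniteIndex ∧ ∀ j : ℤ, x⁻¹ * g ^ j ∉ N) ∨
      ∃ k : ℤ, ∀ M : ℕ, 0 < M → ∃ N : Subgroup G, N.Normal ∧ N.FiniteIndex ∧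
        ∀ j : ℤ, x⁻¹ * g ^ j ∈ N → (M : ℤ) ∣ j - k) :
    @IsClosed G (profiniteTopology G) (Subgroup.zpowers g : Set G) := by
  rw [isClosed_profiniteTopology_zpowers_iff]
  intro x hx
  obtain hN | ⟨k, hk⟩ := h x hx
  · exact hN
  have hne : x⁻¹ * g ^ k ≠ 1 := fun e => hx ⟨k, (inv_mul_eq_one.1 e).symm⟩
  obtain ⟨N, hN, hNf, hxN⟩ := hG _ hne
  -- Since `g ^ N.index ∈ N`, exponents congruent modulo the index give the same coset of `N`, so
  -- `j` may be replaced by `k`.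
  obtain ⟨K, hK, hKf, hKx⟩ := hk N.index (Nat.pos_of_ne_zero hNf.index_ne_zero)
  refine ⟨N ⊓ K, inferInstance, inferInstance, fun j hj => hxN ?_⟩
  obtain ⟨t, ht⟩ := hKx j hj.2
  have hgt : g ^ (k - j) ∈ N := by
    have : k - j = N.index * (-t) := by rw [mul_neg, ← ht]; ring
    rw [this, zpow_mul, zpow_natCast]
    exact N.zpow_mem (N.pow_index_mem g) _
  have := N.mul_mem hj.1 hgt
  rwa [mul_assoc, ← zpow_add, add_sub_cancel] at this

end Separability

/-! ### Words, reduced words and the map to the direct product. -/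

namespace GraphProduct

variable {V : Type*} {Γ : SimpleGraph V} {G : V → Type*} [∀ v, Group (G v)]

/-- The canonical map of a vertex group to the graph product. -/
def of (Γ : SimpleGraph V) {G : V → Type*} [∀ v, Group (G v)] (v : V) : G v →* GraphProduct Γ G :=
  (QuotientGroup.mk' _).comp Monoid.CoprodI.of

theorem of_mul_of_comm {u v : V} (h : Γ.Adj u v) (a : G u) (b : G v) :
    of Γ u a * of Γ v b = of Γ v b * of Γ u a := by
  have hr : Monoid.CoprodI.of a * Monoid.CoprodI.of b *
      (Monoid.CoprodI.of a)⁻¹ * (Monoid.CoprodI.of b)⁻¹ ∈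
        Subgroup.normalClosure (graphProductRel Γ G) :=
    Subgroup.subset_normalClosure ⟨u, v, h, a, b, rfl⟩
  rw [← QuotientGroup.eq_one_iff] at hr
  simp only [QuotientGroup.mk_mul, QuotientGroup.mk_inv] at hr
  rwa [mul_inv_eq_one, mul_inv_eq_iff_eq_mul] at hr

/-- The universal property of the graph product. -/
def lift {H : Type*} [Group H] (f : ∀ v, G v →* H)
    (hf : ∀ u v, Γ.Adj u v → ∀ (a : G u) (b : G v), f u a * f v b = f v b * f u a) :
    GraphProduct Γ G →* H :=
  QuotientGroup.lift _ (Monoid.CoprodI.lift f) <| Subgroup.normalClosure_le_normal <| by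
    rintro _ ⟨u, v, h, a, b, rfl⟩
    simp [MonoidHom.mem_ker, hf u v h a b]

@[simp]
theorem lift_of {H : Type*} [Group H] (f : ∀ v, G v →* H)
    (hf : ∀ u v, Γ.Adj u v → ∀ (a : G u) (b : G v), f u a * f v b = f v b * f u a)
    (v : V) (a : G v) : lift f hf (of Γ v a) = f v a :=
  Monoid.CoprodI.lift_of f a

/-- The element of the graph product represented by a word in the vertex groups. -/
def wordProd (Γ : SimpleGraph V) (l : List (Σ v, G v)) : GraphProduct Γ G :=
  (l.map fun s => of Γ s.1 s.2).prod

@[simp]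
theorem wordProd_nil : wordProd Γ ([] : List (Σ v, G v)) = 1 := rfl

@[simp]
theorem wordProd_cons (s : Σ v, G v) (l : List (Σ v, G v)) :
    wordProd Γ (s :: l) = of Γ s.1 s.2 * wordProd Γ l := by
  simp [wordProd]

@[simp]
theorem wordProd_append (l l' : List (Σ v, G v)) :
    wordProd Γ (l ++ l') = wordProd Γ l * wordProd Γ l' := by
  simp [wordProd]

theorem wordProd_surjective : Function.Surjective (wordProd (G := G) Γ) := by
  intro g
  obtain ⟨x, rfl⟩ := QuotientGroup.mk_surjective g
  induction x using Monoid.CoprodI.induction_on with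
  | one => exact ⟨[], rfl⟩
  | of v a => exact ⟨[⟨v, a⟩], by simp [of]⟩
  | mul x y hx hy =>
    obtain ⟨l, hl⟩ := hx
    obtain ⟨l', hl'⟩ := hy
    exact ⟨l ++ l', by rw [wordProd_append, hl, hl', QuotientGroup.mk_mul]⟩

@[elab_as_elim]
theorem induction_on {p : GraphProduct Γ G → Prop} (g : GraphProduct Γ G) (one : p 1)
    (of_mul : ∀ v a g, p g → p (of Γ v a * g)) : p g := by
  obtain ⟨l, rfl⟩ := wordProd_surjective g
  induction l with
  | nil => exact one
  | cons s l ih => rw [wordProd_cons]; exact of_mul _ _ _ ih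

theorem of_mul_wordProd_comm {v : V} (a : G v) {l : List (Σ v, G v)} (h : ∀ s ∈ l, Γ.Adj s.1 v) :
    of Γ v a * wordProd Γ l = wordProd Γ l * of Γ v a := by
  induction l with
  | nil => simp
  | cons s l ih =>
    rw [wordProd_cons, ← mul_assoc, ← of_mul_of_comm (h s (by simp)), mul_assoc,
      ih fun t ht => h t (by simp [ht]), mul_assoc]

/-- A word is reduced if its letters are nontrivial and any two letters of the same vertex group
are separated by a letter that commutes with neither of them. -/
structure IsReduced (Γ : SimpleGraph V) (l : List (Σ v, G v)) : Prop where
  ne_one : ∀ s ∈ l, s.2 ≠ 1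
  exists_not_adj : ∀ i j : Fin l.length, i < j → (l.get i).1 = (l.get j).1 →
    ∃ k, i < k ∧ k < j ∧ ¬ Γ.Adj (l.get k).1 (l.get i).1

/-- A shortest word is reduced: a trivial letter could be dropped, and two letters of one vertex
group with only commuting letters between them could be merged. -/
theorem exists_isReduced (g : GraphProduct Γ G) :
    ∃ l : List (Σ v, G v), wordProd Γ l = g ∧ IsReduced Γ l := by
  classical
  have hex : ∃ n, ∃ l : List (Σ v, G v), wordProd Γ l = g ∧ l.length = n := by
    obtain ⟨l, hl⟩ := wordProd_surjective g
    exact ⟨_, l, hl, rfl⟩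
  obtain ⟨l, hl, hn⟩ := Nat.find_spec hex
  have hmin : ∀ l' : List (Σ v, G v), wordProd Γ l' = g → l.length ≤ l'.length := fun l' h' =>
    hn ▸ Nat.find_min' hex ⟨l', h', rfl⟩
  refine ⟨l, hl, ⟨fun s hs h1 => ?_, fun i j hij hv => ?_⟩⟩
  · obtain ⟨l₁, l₂, rfl⟩ := List.append_of_mem hs
    have := hmin (l₁ ++ l₂) (by rw [← hl]; simp [h1])
    simp at this
  · by_contra! hk
    have hd : l = l.take i ++ l.get i :: ((l.drop (i + 1)).take (j - (i + 1)) ++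
        l.get j :: l.drop (j + 1)) := by
      conv_lhs => rw [← List.take_append_drop i l, List.drop_eq_getElem_cons i.2,
        ← List.take_append_drop (j - (i + 1)) (l.drop (i + 1)), List.drop_drop,
        show (i : ℕ) + 1 + (j - (i + 1)) = j by have : (i : ℕ) < j := hij; omega,
        List.drop_eq_getElem_cons j.2]
      simp
    have hM : ∀ s ∈ (l.drop (i + 1)).take (j - (i + 1)), Γ.Adj s.1 (l.get i).1 := by
      intro s hs
      obtain ⟨k, hk', rfl⟩ := List.getElem_of_mem hs
      simp only [List.length_take, List.length_drop, lt_inf_iff] at hk'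
      have := hk ⟨i + 1 + k, by omega⟩ (Fin.lt_def.2 (by simp; omega)) (Fin.lt_def.2 (by simp; omega))
      simpa using this
    generalize (l.drop (i + 1)).take (j - (i + 1)) = M at hd hM
    generalize l.take i = A at hd
    generalize l.drop (j + 1) = B at hd
    generalize l.get i = s at hd hM hv
    generalize l.get j = t at hd hv
    obtain ⟨v, a⟩ := s
    obtain ⟨w, b⟩ := t
    obtain rfl : v = w := hv
    have := hmin (A ++ ⟨v, a * b⟩ :: (M ++ B)) (by
      rw [← hl, hd]
      simp only [wordProd_append, wordProd_cons, map_mul, mul_assoc]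
      congr 2
      rw [← mul_assoc, of_mul_wordProd_comm b hM, mul_assoc])
    rw [hd] at this
    simp at this

open Classical in
/-- The canonical map of the graph product to the direct product of the vertex groups. -/
noncomputable def toPi (Γ : SimpleGraph V) (G : V → Type*) [∀ v, Group (G v)] :
    GraphProduct Γ G →* ∀ v, G v :=
  lift (MonoidHom.mulSingle G) fun _ _ h a b => Pi.mulSingle_commute h.ne a b

open Classical in
theorem toPi_of (v : V) (a : G v) : toPi Γ G (of Γ v a) = Pi.mulSingle v a :=
  lift_of _ _ _ _

@[simp]
theorem toPi_of_same (v : V) (a : G v) : toPi Γ G (of Γ v a) v = a := by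
  simp [toPi_of]

theorem toPi_of_ne {u v : V} (h : u ≠ v) (a : G v) : toPi Γ G (of Γ v a) u = 1 := by
  simp [toPi_of, h]

theorem finite_mulSupport_toPi (g : GraphProduct Γ G) : {v | toPi Γ G g v ≠ 1}.Finite := by
  induction g using induction_on with
  | one => simp
  | of_mul v a g ih =>
    refine ((Set.finite_singleton v).union ih).subset fun u hu => ?_
    by_contra hc
    simp only [Set.singleton_union, Set.mem_insert_iff, Set.mem_ofPred_eq, not_or,
      not_not] at hc
    exact hu (by simp [toPi_of_ne hc.1, hc.2])

theorem isOfFinOrder_toPi {g : GraphProduct Γ G} (h : ∀ v, IsOfFinOrder (toPi Γ G g v)) :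
    IsOfFinOrder (toPi Γ G g) := by
  rw [isOfFinOrder_iff_pow_eq_one]
  refine ⟨∏ v ∈ (finite_mulSupport_toPi g).toFinset, orderOf (toPi Γ G g v),
    Finset.prod_pos fun v _ => (h v).orderOf_pos, funext fun v => ?_⟩
  by_cases hv : toPi Γ G g v = 1
  · simp [hv]
  · exact orderOf_dvd_iff_pow_eq_one.1 (Finset.dvd_prod_of_mem (fun v => orderOf (toPi Γ G g v))
      ((finite_mulSupport_toPi g).mem_toFinset.2 hv))

end GraphProduct

/-! ### The integral representation attached to a reduced word. -/

/-- Conjugation of a representation by `1 + X`, where `X` is an element of square zero. -/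
def MonoidHom.conjOneAdd {A R : Type*} [Group A] [Ring R] (T : A →* R) (X : R) (hX : X * X = 0) :
    A →* R where
  toFun a := (1 + X) * T a * (1 - X)
  map_one' := by
    rw [map_one, mul_one, show (1 + X) * (1 - X) = 1 - X * X by noncomm_ring, hX, sub_zero]
  map_mul' a b := by
    have h : (1 - X) * (1 + X) = 1 := by
      rw [show (1 - X) * (1 + X) = 1 - X * X by noncomm_ring, hX, sub_zero]
    calc (1 + X) * T (a * b) * (1 - X) =
        (1 + X) * T a * ((1 - X) * (1 + X)) * (T b * (1 - X)) := by
          rw [h, map_mul, mul_one]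
          simp only [mul_assoc]
      _ = _ := by simp only [mul_assoc]

namespace GraphProduct

variable {V : Type*} (Γ : SimpleGraph V) {n : ℕ} (v : Fin n → V) {Q : Fin n → Type*}

/-- A position `i` of a word with vertices `v` can be added to a set `D` of positions if, among the
positions that do not commute with it, `D` consists of those before `i`. -/
def Addable (D : Finset (Fin n)) (i : Fin n) : Prop :=
  ∀ j, ¬ Γ.Adj (v j) (v i) → (j ∈ D ↔ j < i)

theorem Addable.notMem {D : Finset (Fin n)} {i : Fin n} (h : Addable Γ v D i) : i ∉ D := fun hi =>
  lt_irrefl i ((h i (Γ.loopless.irrefl _)).1 hi)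

variable (φ : ∀ i, Q i → ℤ)

open Classical in
/-- The operator that adds a position of vertex `u`, weighted by `φ`. -/
noncomputable def insertOp (u : V) : Module.End ℤ (Finset (Fin n) × (∀ i, Q i) → ℤ) where
  toFun f s := ∑ i, if v i = u ∧ Addable Γ v s.1 i then φ i (s.2 i) * f (insert i s.1, s.2) else 0
  map_add' f g := by
    ext s
    simp only [Pi.add_apply, ← Finset.sum_add_distrib]
    refine Finset.sum_congr rfl fun i _ => ?_
    split_ifs <;> ring
  map_smul' c f := by
    ext s
    simp only [Pi.smul_apply, smul_eq_mul, Finset.mul_sum, RingHom.id_apply]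
    refine Finset.sum_congr rfl fun i _ => ?_
    split_ifs <;> ring

open Classical in
theorem insertOp_apply (u : V) (f : Finset (Fin n) × (∀ i, Q i) → ℤ)
    (s : Finset (Fin n) × (∀ i, Q i)) : insertOp Γ v φ u f s =
      ∑ i, if v i = u ∧ Addable Γ v s.1 i then φ i (s.2 i) * f (insert i s.1, s.2) else 0 := rfl

/-- Addability of `j` only tests positions not adjacent to it, so adding an adjacent position
changes nothing. Hence insertions at adjacent vertices commute. -/
theorem addable_and_addable_insert_iff {D : Finset (Fin n)} {i j : Fin n}
    (h : Γ.Adj (v i) (v j)) :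
    Addable Γ v D i ∧ Addable Γ v (insert i D) j ↔ Addable Γ v D i ∧ Addable Γ v D j := by
  refine and_congr_right fun _ => forall_congr' fun k => imp_congr_right fun hk => ?_
  have : k ≠ i := by
    rintro rfl
    exact hk h
  simp [this]

open Classical in
theorem insertOp_mul_insertOp_apply {u w : V} (h : Γ.Adj u w)
    (f : Finset (Fin n) × (∀ i, Q i) → ℤ) (s : Finset (Fin n) × (∀ i, Q i)) :
    (insertOp Γ v φ u * insertOp Γ v φ w) f s =
      ∑ i, ∑ j, if v i = u ∧ v j = w ∧ Addable Γ v s.1 i ∧ Addable Γ v s.1 j then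
        φ i (s.2 i) * φ j (s.2 j) * f (insert j (insert i s.1), s.2) else 0 := by
  simp only [Module.End.mul_apply, insertOp_apply]
  refine Finset.sum_congr rfl fun i _ => ?_
  by_cases hi : v i = u ∧ Addable Γ v s.1 i
  · rw [if_pos hi, Finset.mul_sum]
    refine Finset.sum_congr rfl fun j _ => ?_
    rw [mul_ite, mul_zero, ← mul_assoc]
    refine if_congr ?_ rfl rfl
    by_cases hj : v j = w
    · have := addable_and_addable_insert_iff Γ v (D := s.1) (i := i) (j := j) (by rwa [hi.1, hj])
      tauto
    · tauto
  · rw [if_neg hi, Finset.sum_eq_zero]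
    intro j _
    rw [if_neg]
    tauto

theorem commute_insertOp {u w : V} (h : Γ.Adj u w) :
    Commute (insertOp Γ v φ u) (insertOp Γ v φ w) := by
  classical
  refine LinearMap.ext fun f => funext fun s => ?_
  rw [insertOp_mul_insertOp_apply Γ v φ h, insertOp_mul_insertOp_apply Γ v φ h.symm,
    Finset.sum_comm]
  refine Finset.sum_congr rfl fun i _ => Finset.sum_congr rfl fun j _ => ?_
  rw [Finset.insert_comm, mul_comm (φ j _)]
  exact if_congr (by tauto) rfl rfl

/-- This is where reducedness enters. If `i < j`, a separating position `k` would have to be in the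
set for `j` and outside it for `i`; if `j < i`, addability of `i` means that `j` is already present.
-/
theorem not_addable_insert (hred : ∀ i j, i < j → v i = v j →
      ∃ k, i < k ∧ k < j ∧ ¬ Γ.Adj (v k) (v i)) {D : Finset (Fin n)} {i j : Fin n}
    (h : v i = v j) (hi : Addable Γ v D i) : ¬ Addable Γ v (insert i D) j := by
  intro hj
  have hj' : j ∉ insert i D := hj.notMem
  have hne : i ≠ j := by
    rintro rfl
    simp at hj'
  rcases lt_or_gt_of_ne hne with hij | hij
  · obtain ⟨k, hik, hkj, hk⟩ := hred i j hij h
    have h1 := (hj k (h ▸ hk)).2 hkj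
    rcases Finset.mem_insert.1 h1 with rfl | h2
    · exact lt_irrefl _ hik
    · exact lt_asymm hik ((hi k hk).1 h2)
  · refine hj' (Finset.mem_insert_of_mem ((hi j ?_).2 hij))
    rw [h]
    exact Γ.loopless.irrefl _

variable [∀ i, Group (Q i)]

/-- Right translation on the functions on the states `(D, p)`. -/
def translate : (∀ i, Q i) →* Module.End ℤ (Finset (Fin n) × (∀ i, Q i) → ℤ) where
  toFun q := LinearMap.funLeft ℤ ℤ fun s => (s.1, s.2 * q)
  map_one' := by ext; simp [LinearMap.funLeft_apply]
  map_mul' p q := by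
    refine LinearMap.ext fun f => funext fun s => ?_
    simp [LinearMap.funLeft_apply, mul_assoc]

@[simp]
theorem translate_apply (q : ∀ i, Q i) (f : Finset (Fin n) × (∀ i, Q i) → ℤ)
    (s : Finset (Fin n) × (∀ i, Q i)) : translate q f s = f (s.1, s.2 * q) := rfl

theorem commute_insertOp_translate {u : V} {q : ∀ i, Q i} (hq : ∀ i, v i = u → q i = 1) :
    Commute (insertOp Γ v φ u) (translate q) := by
  refine LinearMap.ext fun f => funext fun s => ?_
  simp only [Module.End.mul_apply, insertOp_apply, translate_apply]
  refine Finset.sum_congr rfl fun i _ => ?_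
  split_ifs with h
  · simp [hq i h.1]
  · rfl

theorem insertOp_mul_translate_mul_insertOp (hred : ∀ i j, i < j → v i = v j →
      ∃ k, i < k ∧ k < j ∧ ¬ Γ.Adj (v k) (v i)) (u : V) (q : ∀ i, Q i) :
    insertOp Γ v φ u * translate q * insertOp Γ v φ u = 0 := by
  refine LinearMap.ext fun f => funext fun s => ?_
  simp only [Module.End.mul_apply, insertOp_apply, translate_apply, LinearMap.zero_apply,
    Pi.zero_apply]
  refine Finset.sum_eq_zero fun i _ => ?_
  split_ifs with hi
  · rw [Finset.sum_eq_zero, mul_zero]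
    intro j _
    rw [if_neg]
    exact fun hj => not_addable_insert Γ v hred (hi.1.trans hj.1.symm) hi.2 hj.2
  · rfl

theorem insertOp_mul_self (hred : ∀ i j, i < j → v i = v j →
      ∃ k, i < k ∧ k < j ∧ ¬ Γ.Adj (v k) (v i)) (u : V) :
    insertOp Γ v φ u * insertOp Γ v φ u = 0 := by
  simpa using insertOp_mul_translate_mul_insertOp Γ v φ hred u 1

variable {G : V → Type*} [∀ v, Group (G v)] (q : ∀ i, G (v i) →* Q i)

/-- The homomorphism from the graph product to a product of quotients of vertex groups. -/
noncomputable def toQuotients : GraphProduct Γ G →* ∀ i, Q i :=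
  MonoidHom.pi fun i => (q i).comp ((Pi.evalMonoidHom G (v i)).comp (toPi Γ G))

theorem toQuotients_apply (g : GraphProduct Γ G) (i : Fin n) :
    toQuotients Γ v q g i = q i (toPi Γ G g (v i)) := rfl

theorem toQuotients_of_ne {u : V} {i : Fin n} (h : v i ≠ u) (a : G u) :
    toQuotients Γ v q (of Γ u a) i = 1 := by
  rw [toQuotients_apply, toPi_of_ne h, map_one]

/-- The representation of the graph product attached to a reduced word. -/
noncomputable def rep (hred : ∀ i j, i < j → v i = v j →
      ∃ k, i < k ∧ k < j ∧ ¬ Γ.Adj (v k) (v i)) :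
    GraphProduct Γ G →* (Module.End ℤ (Finset (Fin n) × (∀ i, Q i) → ℤ))ˣ :=
  lift (fun u => ((translate.comp ((toQuotients Γ v q).comp (of Γ u))).conjOneAdd
    (insertOp Γ v φ u) (insertOp_mul_self Γ v φ hred u)).toHomUnits) <| by
    intro u w h a b
    have hX := commute_insertOp Γ v φ h
    have hT : Commute (translate (toQuotients Γ v q (of Γ u a)))
        (translate (toQuotients Γ v q (of Γ w b))) := by
      rw [Commute, SemiconjBy, ← map_mul, ← map_mul, ← map_mul, ← map_mul, of_mul_of_comm h]
    have h1 : Commute (insertOp Γ v φ u) (translate (toQuotients Γ v q (of Γ w b))) :=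
      commute_insertOp_translate Γ v φ fun i hi => toQuotients_of_ne Γ v q (hi ▸ h.ne) b
    have h2 : Commute (insertOp Γ v φ w) (translate (toQuotients Γ v q (of Γ u a))) :=
      commute_insertOp_translate Γ v φ fun i hi => toQuotients_of_ne Γ v q (hi ▸ h.ne') a
    have hone : ∀ x : Module.End ℤ (Finset (Fin n) × (∀ i, Q i) → ℤ), Commute 1 x :=
      Commute.one_left
    have key : ∀ x, Commute (insertOp Γ v φ u) x →
        Commute (translate (toQuotients Γ v q (of Γ u a))) x →
        Commute ((1 + insertOp Γ v φ u) * translate (toQuotients Γ v q (of Γ u a)) *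
          (1 - insertOp Γ v φ u)) x := fun x hx hx' =>
      (((hone x).add_left hx).mul_left hx').mul_left ((hone x).sub_left hx)
    -- Insertion and translation at `u` each commute with both operators at `w`, so the two
    -- conjugates commute.
    refine Units.ext (key _ ?_ ?_)
    · exact ((((hone _).symm.add_right hX)).mul_right h1).mul_right ((hone _).symm.sub_right hX)
    · exact ((((hone _).symm.add_right h2.symm)).mul_right hT).mul_right
        ((hone _).symm.sub_right h2.symm)

-- As `X * T * X = 0`, the conjugate `(1 + X) * T * (1 - X)` equals `T + (X * T - T * X)`: a letter
-- adds at most one position, weighted by the change of `φ` under translation.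
open Classical in
theorem rep_of_apply (hred : ∀ i j, i < j → v i = v j →
      ∃ k, i < k ∧ k < j ∧ ¬ Γ.Adj (v k) (v i)) (u : V) (a : G u)
    (f : Finset (Fin n) × (∀ i, Q i) → ℤ) (s : Finset (Fin n) × (∀ i, Q i)) :
    (rep Γ v φ q hred (of Γ u a)).1 f s = f (s.1, s.2 * toQuotients Γ v q (of Γ u a)) +
      ∑ i, if v i = u ∧ Addable Γ v s.1 i then
        (φ i (s.2 i) - φ i ((s.2 * toQuotients Γ v q (of Γ u a)) i)) *
          f (insert i s.1, s.2 * toQuotients Γ v q (of Γ u a)) else 0 := by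
  have h : (rep Γ v φ q hred (of Γ u a)).1 =
      translate (toQuotients Γ v q (of Γ u a)) +
        (insertOp Γ v φ u * translate (toQuotients Γ v q (of Γ u a)) -
        translate (toQuotients Γ v q (of Γ u a)) * insertOp Γ v φ u) := by
    have : (rep Γ v φ q hred (of Γ u a)).1 =
      (1 + insertOp Γ v φ u) * translate (toQuotients Γ v q (of Γ u a)) *
          (1 - insertOp Γ v φ u) := by
      rw [rep, lift_of]
      rfl
    rw [this]
    have h0 := insertOp_mul_translate_mul_insertOp Γ v φ hred u (toQuotients Γ v q (of Γ u a))
    rw [mul_sub, mul_one, add_mul, add_mul, one_mul, h0]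
    abel
  rw [h]
  simp only [LinearMap.add_apply, LinearMap.sub_apply, Module.End.mul_apply, insertOp_apply,
    translate_apply, Pi.add_apply, Pi.sub_apply, ← Finset.sum_sub_distrib]
  congr 1
  refine Finset.sum_congr rfl fun i _ => ?_
  split_ifs <;> ring

end GraphProduct

/-! ### Unipotent operators and congruence quotients. -/

section LinearAlgebra

/-- With nilpotency index `m + 2`, take an image under `N ^ m` not killed by `N`. For unipotent `1 +
N` this gives a vector whose orbit grows linearly in the exponent. -/
theorem Module.End.exists_apply_ne_zero_apply_apply_eq_zero {R M : Type*} [Semiring R]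
    [AddCommMonoid M] [Module R M] {N : Module.End R M} (hN : IsNilpotent N) (h : N ≠ 0) :
    ∃ f, N f ≠ 0 ∧ N (N f) = 0 := by
  classical
  obtain ⟨m, hm⟩ : ∃ m, Nat.find hN = m + 2 := by
    obtain h0 | h0 | ⟨m, hm⟩ : Nat.find hN = 0 ∨ Nat.find hN = 1 ∨ ∃ m, Nat.find hN = m + 2 := by
      rcases Nat.find hN with _ | _ | m <;> simp
    · have := Nat.find_spec hN
      rw [h0, pow_zero] at this
      exact (h (by rw [← mul_one N, this, mul_zero])).elim
    · have := Nat.find_spec hN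
      rw [h0, pow_one] at this
      exact (h this).elim
    · exact ⟨m, hm⟩
  have h1 : N ^ (m + 1) ≠ 0 := Nat.find_min hN (by omega)
  have h2 : N ^ (m + 2) = 0 := hm ▸ Nat.find_spec hN
  obtain ⟨f, hf⟩ : ∃ f, (N ^ (m + 1)) f ≠ 0 := by
    by_contra! hc
    exact h1 (LinearMap.ext hc)
  refine ⟨(N ^ m) f, ?_, ?_⟩
  · rwa [pow_succ', Module.End.mul_apply] at hf
  · rw [← Module.End.mul_apply, ← Module.End.mul_apply, mul_assoc, ← pow_succ', ← pow_succ', h2]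
    rfl

theorem Module.End.zpow_apply_of_apply_eq_add {R M : Type*} [Ring R]
    [AddCommGroup M] [Module R M] {U : (Module.End R M)ˣ} {f w : M} (hf : U.1 f = f + w)
    (hw : U.1 w = w) (k : ℤ) : (U ^ k).1 f = f + k • w := by
  have hinv : ∀ x, (U⁻¹).1 (U.1 x) = x := fun x => by
    rw [← Module.End.mul_apply, ← Units.val_mul, inv_mul_cancel]
    rfl
  have hw' : (U⁻¹).1 w = w := by
    conv_lhs => rw [← hw]
    exact hinv w
  have hf' : (U⁻¹).1 f = f - w := by
    have := hinv (f - w)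
    rwa [map_sub, hf, hw, add_sub_cancel_right] at this
  induction k using Int.induction_on with
  | zero => simp
  | succ i ih =>
    rw [add_comm, zpow_add, zpow_one, Units.val_mul, Module.End.mul_apply, ih, map_add, hf,
      map_zsmul, hw, add_smul, one_smul, add_assoc]
  | pred i ih =>
    rw [sub_eq_neg_add, zpow_add, zpow_neg_one, Units.val_mul, Module.End.mul_apply, ih, map_add,
      hf', map_zsmul, hw', add_smul, neg_one_smul]
    abel

/-- The congruence quotients of an integral representation are finite. -/
theorem exists_congruence_subgroup {A B : Type*} [Group A] [Finite B]
    (ρ : A →* (Module.End ℤ (B → ℤ))ˣ) {M : ℕ} (hM : 0 < M) :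
    ∃ N : Subgroup A, N.Normal ∧ N.FiniteIndex ∧ ∀ x y, x⁻¹ * y ∈ N →
      ∀ f b, (M : ℤ) ∣ (ρ y).1 f b - (ρ x).1 f b := by
  classical
  have := Fintype.ofFinite B
  have : NeZero M := ⟨hM.ne'⟩
  let ψ : Module.End ℤ (B → ℤ) →* Matrix B B (ZMod M) :=
    (RingHom.mapMatrix (m := B) (Int.castRingHom (ZMod M))).toMonoidHom.comp
      (LinearMap.toMatrixAlgEquiv' : Module.End ℤ (B → ℤ) ≃ₐ[ℤ] Matrix B B ℤ).toMonoidHom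
  let χ : A →* (Matrix B B (ZMod M))ˣ := (Units.map ψ).comp ρ
  refine ⟨χ.ker, inferInstance, inferInstance, fun x y hxy f b => ?_⟩
  have h1 : χ x = χ y := by
    rw [MonoidHom.mem_ker, map_mul, map_inv, inv_mul_eq_one] at hxy
    exact hxy
  have h2 : ψ (ρ x).1 = ψ (ρ y).1 := congrArg Units.val h1
  have key : ∀ g : Module.End ℤ (B → ℤ),
      ((g f b : ℤ) : ZMod M) = (ψ g).mulVec (fun b => (f b : ZMod M)) b := by
    intro g
    have : g f = (LinearMap.toMatrixAlgEquiv' g).mulVec f := by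
      rw [← Matrix.toLinAlgEquiv'_apply, Matrix.toLinAlgEquiv'_toMatrixAlgEquiv']
    rw [this]
    exact RingHom.map_mulVec (Int.castRingHom (ZMod M)) _ _ _
  rw [← ZMod.intCast_eq_intCast_iff_dvd_sub, key, key, h2]

/-- A nontrivial element of a residually finite group generates a closed subgroup if an integral
representation maps it to a nontrivial unipotent element. -/
theorem IsResiduallyFinite.isClosed_zpowers_of_unipotent {A B : Type*} [Group A] [Finite B]
    (hA : IsResiduallyFinite A) (ρ : A →* (Module.End ℤ (B → ℤ))ˣ) {g : A} (h1 : ρ g ≠ 1)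
    (hg : IsNilpotent ((ρ g).1 - 1)) :
    @IsClosed A (profiniteTopology A) (Subgroup.zpowers g : Set A) := by
  obtain ⟨f, hf, hff⟩ := Module.End.exists_apply_ne_zero_apply_apply_eq_zero hg
    (sub_ne_zero.2 fun h => h1 (Units.ext h))
  obtain ⟨b, hb⟩ := Function.ne_iff.1 hf
  generalize hw : ((ρ g).1 - 1) f = w at hf hff hb
  have hpow : ∀ j : ℤ, (ρ (g ^ j)).1 f b = f b + j * w b := by
    intro j
    rw [map_zpow, Module.End.zpow_apply_of_apply_eq_add (w := w)]
    · simp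
    · rw [← hw]; simp
    · rw [LinearMap.sub_apply, sub_eq_zero] at hff
      exact hff
  replace hb : w b ≠ 0 := hb
  refine hA.isClosed_zpowers fun x _ => ?_
  by_cases hx : w b ∣ (ρ x).1 f b - f b
  · obtain ⟨k, hk⟩ := hx
    refine Or.inr ⟨k, fun M hM => ?_⟩
    -- The congruence reads `w b * (j - k) ≡ 0`; the extra factor `w b` in the modulus cancels and
    -- leaves divisibility by `M`.
    obtain ⟨N, hN, hNf, h⟩ := exists_congruence_subgroup ρ
      (Nat.mul_pos (Int.natAbs_pos.2 hb) hM)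
    refine ⟨N, hN, hNf, fun j hj => ?_⟩
    have := h _ _ hj f b
    rw [hpow, show f b + j * w b - (ρ x).1 f b = w b * (j - k) by linarith, Nat.cast_mul,
      Int.natCast_natAbs, ← Int.natAbs_dvd_natAbs, Int.natAbs_mul, Int.natAbs_mul,
      Int.natAbs_abs] at this
    exact Int.natAbs_dvd_natAbs.1 (Nat.dvd_of_mul_dvd_mul_left (Int.natAbs_pos.2 hb) this)
  · left
    obtain ⟨N, hN, hNf, h⟩ := exists_congruence_subgroup ρ (Int.natAbs_pos.2 hb)
    refine ⟨N, hN, hNf, fun j hj => hx ?_⟩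
    have := h _ _ hj f b
    rw [hpow, Int.natAbs_dvd] at this
    have h2 := (Dvd.intro_left j (rfl : j * w b = _)).sub this
    rwa [show j * w b - (f b + j * w b - (ρ x).1 f b) = (ρ x).1 f b - f b by ring] at h2

end LinearAlgebra

/-! ### Unipotence on the kernel of `toPi`. -/

namespace GraphProduct

variable {V : Type*} (Γ : SimpleGraph V) {n : ℕ} (v : Fin n → V) {Q : Fin n → Type*}
  [∀ i, Group (Q i)] (φ : ∀ i, Q i → ℤ) {G : V → Type*} [∀ v, Group (G v)]
  (q : ∀ i, G (v i) →* Q i)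

theorem rep_apply_of_forall_eq_zero (hred : ∀ i j, i < j → v i = v j →
      ∃ k, i < k ∧ k < j ∧ ¬ Γ.Adj (v k) (v i)) (g : GraphProduct Γ G)
    (f : Finset (Fin n) × (∀ i, Q i) → ℤ) (s : Finset (Fin n) × (∀ i, Q i))
    (h : ∀ s' : Finset (Fin n) × (∀ i, Q i), s.1.card < s'.1.card → f s' = 0) :
    (rep Γ v φ q hred g).1 f s = f (s.1, s.2 * toQuotients Γ v q g) := by
  classical
  induction g using induction_on generalizing s with
  | one => simp
  | of_mul u a g ih =>
    rw [map_mul, Units.val_mul, Module.End.mul_apply, rep_of_apply, Finset.sum_eq_zero, add_zero,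
      ih (s.1, s.2 * toQuotients Γ v q (of Γ u a)) h, map_mul, mul_assoc]
    intro i _
    split_ifs with hi
    · have hc : s.1.card < (insert i s.1).card := by
        rw [Finset.card_insert_of_notMem hi.2.notMem]
        exact Nat.lt_succ_self _
      rw [ih (insert i s.1, s.2 * toQuotients Γ v q (of Γ u a)) fun s' hs' => h s' (hc.trans hs'), h _ hc, mul_zero]
    · rfl

theorem isNilpotent_rep_sub_one (hred : ∀ i j, i < j → v i = v j →
      ∃ k, i < k ∧ k < j ∧ ¬ Γ.Adj (v k) (v i)) {g : GraphProduct Γ G}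
    (hg : toPi Γ G g = 1) : IsNilpotent ((rep Γ v φ q hred g).1 - 1) := by
  have hq : toQuotients Γ v q g = 1 := funext fun i => by simp [toQuotients_apply, hg]
  -- Filter functions by the cardinality at which they start to vanish. A kernel element translates
  -- trivially, so subtracting 1 lowers this bound by one each time.
  have key : ∀ k (f : Finset (Fin n) × (∀ i, Q i) → ℤ), (∀ s, k ≤ s.1.card → f s = 0) →
      (((rep Γ v φ q hred g).1 - 1) ^ k) f = 0 := by
    intro k
    induction k with
    | zero =>
      intro f hf
      rw [pow_zero, Module.End.one_apply]
      exact funext fun s => hf s (Nat.zero_le _)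
    | succ k ih =>
      intro f hf
      rw [pow_succ, Module.End.mul_apply]
      refine ih _ fun s hs => ?_
      rw [LinearMap.sub_apply, Pi.sub_apply, rep_apply_of_forall_eq_zero _ _ _ _ _ _ _ _
        fun s' hs' => hf s' (by omega), hq]
      simp
  refine ⟨n + 1, LinearMap.ext fun f => key _ f fun s hs => ?_⟩
  have := s.1.card_le_univ
  rw [Fintype.card_fin] at this
  omega

end GraphProduct

/-! ### Nontrivial action of a reduced word, and residual finiteness. -/

namespace GraphProduct

variable {V : Type*} {Γ : SimpleGraph V} {G : V → Type*} [∀ v, Group (G v)]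

/-- Take `f` to be the indicator of the full set of positions. To reach it from `∅`, each of the
`l.length` letters must add a position, and the only way is to add them in order. The weights `φ`
mark the coordinate just before each letter acts, so every step contributes the factor `1 - 0`. -/
theorem exists_rep_apply_eq_one {l : List (Σ v, G v)} (hl : IsReduced Γ l)
    {Q : Fin l.length → Type*} [∀ i, Group (Q i)] (q : ∀ i, G (l.get i).1 →* Q i)
    (hq : ∀ i, q i (l.get i).2 ≠ 1) :
    ∃ (φ : ∀ i, Q i → ℤ) (f : Finset (Fin l.length) × (∀ i, Q i) → ℤ),
      (l ≠ [] → f (∅, 1) = 0) ∧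
      (rep Γ (fun i => (l.get i).1) φ q hl.exists_not_adj (wordProd Γ l)).1 f (∅, 1) = 1 := by
  classical
  set v : Fin l.length → V := fun i => (l.get i).1 with hv
  let φ : ∀ i, Q i → ℤ := fun i x =>
    if x = toQuotients Γ v q (wordProd Γ (l.take i)) i then 1 else 0
  let f : Finset (Fin l.length) × (∀ i, Q i) → ℤ := fun s => if s.1 = Finset.univ then 1 else 0
  let D : ℕ → Finset (Fin l.length) := fun m => Finset.univ.filter fun i => (i : ℕ) < m
  have key : ∀ k m, m + k = l.length →
      (∀ s, s.1.card < m →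
        (rep Γ v φ q hl.exists_not_adj (wordProd Γ (l.drop m))).1 f s = 0) ∧
      (rep Γ v φ q hl.exists_not_adj (wordProd Γ (l.drop m))).1 f
        (D m, toQuotients Γ v q (wordProd Γ (l.take m))) = 1 := by
    intro k
    induction k with
    | zero =>
      rintro m rfl
      simp only [List.drop_length, wordProd_nil, map_one, Units.val_one,
        Module.End.one_apply]
      refine ⟨fun s hs => if_neg fun h => ?_, if_pos ?_⟩
      · rw [h] at hs
        simp at hs
      · simp [D]
    | succ k ih =>
      intro m hm
      obtain ⟨ih0, ih1⟩ := ih (m + 1) (by omega)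
      have hml : m < l.length := by omega
      have hstep : wordProd Γ (l.drop m) =
          of Γ (v ⟨m, hml⟩) (l.get ⟨m, hml⟩).2 * wordProd Γ (l.drop (m + 1)) := by
        rw [List.drop_eq_getElem_cons hml, wordProd_cons]
        rfl
      have htake : toQuotients Γ v q (wordProd Γ (l.take m)) *
          toQuotients Γ v q (of Γ (v ⟨m, hml⟩) (l.get ⟨m, hml⟩).2) =
            toQuotients Γ v q (wordProd Γ (l.take (m + 1))) := by
        rw [← map_mul, List.take_succ_eq_append_getElem hml, wordProd_append, wordProd_cons,
          wordProd_nil, mul_one]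
        rfl
      have hDcard : (D m).card = m := by
        simp only [D, Fin.card_filter_val_lt]
        omega
      rw [hstep, map_mul, Units.val_mul]
      refine ⟨fun s hs => ?_, ?_⟩
      · rw [Module.End.mul_apply, rep_of_apply, ih0 _ (by simp only; omega), zero_add]
        refine Finset.sum_eq_zero fun i _ => ?_
        split_ifs with hi
        · rw [ih0, mul_zero]
          have := Finset.card_insert_le i s.1
          simp only
          omega
        · rfl
      · rw [Module.End.mul_apply, rep_of_apply, ih0 _ (by simp only; omega), zero_add,
          Finset.sum_eq_single ⟨m, hml⟩]
        · have hins : insert ⟨m, hml⟩ (D m) = D (m + 1) := by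
            ext i
            simp only [D, Finset.mem_insert, Finset.mem_filter, Finset.mem_univ, true_and,
              Fin.ext_iff]
            omega
          rw [if_pos, htake, hins, ih1, mul_one]
          · have h1 : φ ⟨m, hml⟩ (toQuotients Γ v q (wordProd Γ (l.take m)) ⟨m, hml⟩) = 1 :=
              if_pos rfl
            have h2 : φ ⟨m, hml⟩
                (toQuotients Γ v q (wordProd Γ (l.take (m + 1))) ⟨m, hml⟩) = 0 := by
              refine if_neg ?_
              rw [← htake, Pi.mul_apply, mul_eq_left, toQuotients_apply]
              rw [toPi_of_same]
              exact hq _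
            rw [h1, h2, sub_zero]
          · refine ⟨rfl, fun j _ => ?_⟩
            simp [D, Fin.lt_def]
        -- Addability to the initial segment `D m` forces `m ≤ i`, and, as `m` has the same vertex
        -- as `i`, also `i ≤ m`.
        · intro i _ hi
          refine if_neg fun ⟨h1, h2⟩ => hi ?_
          have ha := h2 i (Γ.loopless.irrefl _)
          have hb := h2 ⟨m, hml⟩ (by rw [h1]; exact Γ.loopless.irrefl _)
          simp only [D, Finset.mem_filter, Finset.mem_univ, true_and, Fin.lt_def, lt_self_iff_false,
            iff_false, false_iff] at ha hb
          exact Fin.ext (by simp only; omega)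
        · exact fun h => (h (Finset.mem_univ _)).elim
  refine ⟨φ, f, fun hne => if_neg fun h => ?_, ?_⟩
  · have h0 : 0 < l.length := List.length_pos_of_ne_nil hne
    have : (⟨0, h0⟩ : Fin l.length) ∈ (∅ : Finset (Fin l.length)) := by
      rw [show (∅ : Finset (Fin l.length)) = Finset.univ from h]
      exact Finset.mem_univ _
    simp at this
  · have := (key l.length 0 (by omega)).2
    simpa only [D, Nat.not_lt_zero, Finset.filter_false, List.drop_zero, List.take_zero,
      wordProd_nil, map_one] using this

/-- If the vertex groups are residually finite, each nontrivial element `g` of the graph product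
acts nontrivially in an integral representation in which the kernel of the map to the direct
product acts by unipotent operators. -/
theorem exists_rep.{u, w} {V : Type u} {Γ : SimpleGraph V} {G : V → Type w} [∀ v, Group (G v)]
    (hG : ∀ v, IsResiduallyFinite (G v)) {g : GraphProduct Γ G} (hg : g ≠ 1) :
    ∃ (B : Type w) (_ : Finite B) (ρ : GraphProduct Γ G →* (Module.End ℤ (B → ℤ))ˣ),
      (∃ f b, (ρ g).1 f b = 1 ∧ f b = 0) ∧
        ∀ h, toPi Γ G h = 1 → IsNilpotent ((ρ h).1 - 1) := by
  obtain ⟨l, rfl, hl⟩ := exists_isReduced g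
  have hne : l ≠ [] := by
    rintro rfl
    exact hg rfl
  choose N hN hNf hNx using fun i => hG (l.get i).1 (l.get i).2 (hl.ne_one _ (l.get_mem i))
  obtain ⟨φ, f, h0, h1⟩ := exists_rep_apply_eq_one hl (fun i => QuotientGroup.mk' (N i)) fun i h =>
    hNx i ((QuotientGroup.eq_one_iff _).1 h)
  exact ⟨_, inferInstance, _, ⟨f, _, h1, h0 hne⟩, fun h hh => isNilpotent_rep_sub_one _ _ _ _ _ hh⟩

theorem isResiduallyFinite (hG : ∀ v, IsResiduallyFinite (G v)) :
    IsResiduallyFinite (GraphProduct Γ G) := by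
  intro g hg
  obtain ⟨B, _, ρ, ⟨f, b, h1, h0⟩, -⟩ := exists_rep hG hg
  obtain ⟨N, hN, hNf, h⟩ := exists_congruence_subgroup ρ two_pos
  refine ⟨N, hN, hNf, fun hgN => ?_⟩
  have := h 1 g (by simpa using hgN) f b
  rw [h1, map_one, Units.val_one, Module.End.one_apply, h0] at this
  norm_num at this

theorem isClosed_zpowers_of_toPi_eq_one (hG : ∀ v, IsResiduallyFinite (G v)) {g : GraphProduct Γ G}
    (hg : toPi Γ G g = 1) :
    @IsClosed _ (profiniteTopology (GraphProduct Γ G)) (Subgroup.zpowers g : Set _) := by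
  by_cases h : g = 1
  · rw [h]
    exact isResiduallyFinite_iff_isClosed_zpowers_one.1 (isResiduallyFinite hG)
  · obtain ⟨B, _, ρ, ⟨f, b, h1, h0⟩, hρ⟩ := exists_rep hG h
    refine (isResiduallyFinite hG).isClosed_zpowers_of_unipotent ρ (fun e => ?_) (hρ g hg)
    rw [e, Units.val_one, Module.End.one_apply, h0] at h1
    exact zero_ne_one h1

end GraphProduct

/-! ### Elements with a coordinate of infinite order, and the conclusion. -/

theorem Subgroup.finiteIndex_comap {A H : Type*} [Group A] [Group H] (N : Subgroup H)
    [N.FiniteIndex] (φ : A →* H) : (N.comap φ).FiniteIndex :=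
  ⟨by rw [Subgroup.index_comap]; exact (N.instFiniteIndex_subgroupOf φ.range).index_ne_zero⟩

/-- In a residually finite group, an element generates a closed subgroup if some homomorphism to a
cyclic subgroup separable group maps it to an element of infinite order. -/
theorem IsResiduallyFinite.isClosed_zpowers_of_map {A H : Type*} [Group A] [Group H]
    (hA : IsResiduallyFinite A) (hH : IsCyclicSubgroupSeparable H) (φ : A →* H) {g : A}
    (hg : ¬ IsOfFinOrder (φ g)) :
    @IsClosed A (profiniteTopology A) (Subgroup.zpowers g : Set A) := by
  refine hA.isClosed_zpowers fun x _ => ?_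
  by_cases hx : φ x ∈ Subgroup.zpowers (φ g)
  · obtain ⟨k, hk⟩ := hx
    simp only at hk
    refine Or.inr ⟨k, fun M hM => ?_⟩
    obtain ⟨N, hN, hNf, h⟩ := hH.exists_dvd_of_zpow_mem hg hM
    refine ⟨N.comap φ, inferInstance, N.finiteIndex_comap φ, fun j hj => h _ ?_⟩
    rw [Subgroup.mem_comap, map_mul, map_inv, map_zpow, ← hk, ← zpow_neg, ← zpow_add] at hj
    rwa [sub_eq_neg_add]
  · obtain ⟨N, hN, hNf, h⟩ :=
      isClosed_profiniteTopology_zpowers_iff.1 (hH.isClosed_zpowers (φ g)) _ hx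
    refine Or.inl ⟨N.comap φ, inferInstance, N.finiteIndex_comap φ, fun j hj => h j ?_⟩
    simpa using hj

theorem theoremA {V : Type*} (Γ : SimpleGraph V) (G : V → Type*) [∀ v, Group (G v)]
    (hG : ∀ v, IsCyclicSubgroupSeparable (G v)) :
    IsCyclicSubgroupSeparable (GraphProduct Γ G) := by
  have hR : ∀ v, IsResiduallyFinite (G v) := fun v => (hG v).isResiduallyFinite
  refine isCyclicSubgroupSeparable_of_isClosed_zpowers fun g => ?_
  by_cases h : ∀ v, IsOfFinOrder (GraphProduct.toPi Γ G g v)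
  · obtain ⟨m, hm, hgm⟩ := (GraphProduct.isOfFinOrder_toPi h).exists_pow_eq_one
    rw [← map_pow] at hgm
    exact isClosed_zpowers_of_pow hm (GraphProduct.isClosed_zpowers_of_toPi_eq_one hR hgm)
  · push Not at h
    obtain ⟨v, hv⟩ := h
    exact (GraphProduct.isResiduallyFinite hR).isClosed_zpowers_of_map (hG v)
      ((Pi.evalMonoidHom G v).comp (GraphProduct.toPi Γ G)) hv
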